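/- Let $G$ be a locally compact (Hausdorff) abelian group with Haar measure $\mu_G$, and let $t\mapsto U(t)$ be a weakly continuous unitary representation of $G$ on a separable complex Hilbert space $\mathcal H$. Fix $\phi\in\mathcal H$ such that $\{U(t)\phi\}_{t\in G}$ is a continuous frame for $\mathcal H$ with respect to $\mu_G$, i.e. there are $0<A\le B$ with $A\|x\|^2\le\int_G|\langle x,U(t)\phi\rangle|^2\,d\mu_G(t)\le B\|x\|^2$ for all $x\in\mathcal H$. Let $H$ be a countable discrete subgroup of $G$, let $N\ge 1$ and let $\Phi=\{\varphi_1,\dots,\varphi_N\}\subset\mathcal H$ be such that $\{U(h)\varphi_n\}_{h\in H,\,1\le n\le N}$ is a Riesz basis for $$\mathcal H_\Phi=\Big\{\sum_{n=1}^N\sum_{h\in H}x_n(h)\,U(h)\varphi_n : x_1,\dots,x_N\in\ell^2(H)\Big\}.$$ Let $\mathcal H_{U,\phi,\Phi}$ be the space of the functions $F_f:G\to\mathbb C$, $F_f(t)=\langle f,U(t)\phi\rangle$, with $f\in\mathcal H_\Phi$, regarded as a subspace of $L^2(G)$. (i) If every $F\in\mathcal H_{U,\phi,\Phi}$ is determined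 by its samples $\{F(t)\}_{t\in H}$ (that is, if $F\mapsto F|_H$ is injective on $\mathcal H_{U,\phi,\Phi}$), then $N=1$. (ii) Let $N=1$, and let $a(s)=\langle\varphi_1,U(s)\phi\rangle$ for $s\in H$. Then $a\in\ell^2(H)$. Let $\widehat a\in L^2(\widehat H)$ be its Fourier transform on the compact dual group $\widehat H$ (the continuous extension to $\ell^2(H)$ of $\widehat x(\xi)=\sum_{h\in H}x(h)\overline{\xi(h)}$). If $\widehat a\in L^\infty(\widehat H)$ and $\operatorname{ess\,inf}_{\xi\in\widehat H}|\widehat a(\xi)|>0$, then there is a unique function $S_a\in\mathcal H_{U,\phi,\Phi}$ such that $$F(s)=\sum_{t\in H}F(t)\,S_a(s-t),\qquad s\in G,$$ for every $F\in\mathcal H_{U,\phi,\Phi}$. The series converges absolutely at each point of $G$, uniformly on $G$, and in $L^2(G)$; the uniqueness holds already among the functions of $\mathcal H_{U,\phi,\Phi}$ for which the expansion converges (absolutely) pointwise. Moreover, $\{S_a(\cdot-t)\}_{t\in H}$ is a Riesz basis for $\mathcal H_{U,\phi,\Phi}$. -/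

import Mathlib

open MeasureTheory Filter Topology
open scoped ENNReal

noncomputable section

/-! ### The dual group of a discrete abelian group and the Fourier transform on `ℓ²` -/

/-- The Borel σ-algebra on a dual group. -/
instance pontryaginDualMeasurableSpace (A : Type*) [Monoid A] [TopologicalSpace A] :
    MeasurableSpace (PontryaginDual A) := borel _

instance pontryaginDualBorelSpace (A : Type*) [Monoid A] [TopologicalSpace A] :
    BorelSpace (PontryaginDual A) := ⟨rfl⟩

/-- The dual group `Ĥ` of an additive group `H`: the (continuous) homomorphisms from `H` to the
circle. -/
abbrev DualGroup (H : Type*) [AddCommGroup H] [TopologicalSpace H] : Type _ :=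
  PontryaginDual (Multiplicative H)

section Fourier

variable (H : Type*) [AddCommGroup H] [TopologicalSpace H] [DiscreteTopology H]

/-- The multiplicative copy of a discrete group is discrete, so that `Ĥ` is compact. -/
instance multiplicativeDiscreteTopology : DiscreteTopology (Multiplicative H) :=
  inferInstanceAs (DiscreteTopology H)

/-- The Haar measure on the compact group `Ĥ`, of total mass one. -/
def dualHaar : Measure (DualGroup H) :=
  Measure.haarMeasure (⊤ : TopologicalSpace.PositiveCompacts (DualGroup H))

instance dualHaarIsHaarMeasure : (dualHaar H).IsHaarMeasure := by
  unfold dualHaar; infer_instance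

instance dualHaarIsProbabilityMeasure : IsProbabilityMeasure (dualHaar H) :=
  ⟨by
    have h := Measure.haarMeasure_self (K₀ := (⊤ : TopologicalSpace.PositiveCompacts (DualGroup H)))
    simpa [dualHaar] using h⟩

variable {H}

/-- The value `(h, ξ)` of the character `ξ` at `h`. -/
def pairing (h : H) (ξ : DualGroup H) : ℂ := (ξ (Multiplicative.ofAdd h) : ℂ)

/-- The continuous function `ξ ↦ conj (h, ξ)` on `Ĥ`. -/
def conjCharacter (h : H) : C(DualGroup H, ℂ) where
  toFun ξ := (starRingEnd ℂ) (pairing h ξ)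
  continuous_toFun := by
    have h1 : Continuous fun ξ : DualGroup H => ξ (Multiplicative.ofAdd h) :=
      (continuous_eval_const (F := C(Multiplicative H, Circle)) _).comp
        (ContinuousMonoidHom.isInducing_toContinuousMap _ _).continuous
    exact Complex.continuous_conj.comp (continuous_subtype_val.comp h1)

/-- The class of `ξ ↦ conj (h, ξ)` in `L²(Ĥ)`. -/
def conjCharacterL2 (h : H) : Lp ℂ 2 (dualHaar H) :=
  ContinuousMap.toLp 2 (dualHaar H) ℂ (conjCharacter h)

/-- Characters separate the points of `H`. -/
theorem exists_pairing_ne_one {h : H} (hh : h ≠ 0) : ∃ ξ : DualGroup H, pairing h ξ ≠ 1 := by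
  obtain ⟨c, hc⟩ := CharacterModule.exists_character_apply_ne_zero_of_ne_zero hh
  let f : ℚ →+ Additive Circle :=
    { toFun := fun q => Additive.ofMul (Circle.exp (2 * Real.pi * (q : ℝ)))
      map_zero' := by simp
      map_add' := fun p q => by
        rw [← ofMul_mul, ← Circle.exp_add]; push_cast; ring_nf }
  have hf : ∀ q : ℚ, f q = 0 ↔ q ∈ AddSubgroup.zmultiples (1 : ℚ) := by
    intro q
    change Circle.exp (2 * Real.pi * (q : ℝ)) = 1 ↔ _
    rw [Circle.exp_eq_one, AddSubgroup.mem_zmultiples_iff]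
    refine exists_congr fun n => ?_
    have hpi := Real.pi_pos
    constructor
    · intro h1
      have h2 : (q : ℝ) = n := by
        have h3 : 2 * Real.pi * ((q : ℝ) - n) = 0 := by linarith
        rcases mul_eq_zero.mp h3 with h4 | h4 <;> linarith
      have h5 : q = n := by exact_mod_cast h2
      simp [h5]
    · intro h1
      have h5 : q = n := by simpa using h1.symm
      rw [h5]; push_cast; ring
  let g : AddCircle (1 : ℚ) →+ Additive Circle :=
    QuotientAddGroup.lift _ f fun q hq => (hf q).mpr hq
  have hg : ∀ y : AddCircle (1 : ℚ), g y = 0 → y = 0 := by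
    intro y
    induction y using QuotientAddGroup.induction_on with
    | H q =>
      intro hy
      exact (QuotientAddGroup.eq_zero_iff q).mpr ((hf q).mp hy)
  let c' : H →+ AddCircle (1 : ℚ) := c
  let ξ : DualGroup H :=
    { toMonoidHom := AddMonoidHom.toMultiplicativeLeft (g.comp c')
      continuous_toFun := continuous_of_discreteTopology }
  refine ⟨ξ, fun h1 => hc (hg _ ?_)⟩
  have h2 : ξ (Multiplicative.ofAdd h) = 1 := Circle.ext h1
  exact h2

/-- The characters of the compact group `Ĥ` that come from `H` are orthonormal. -/
theorem orthonormal_conjCharacterL2 :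
    Orthonormal ℂ (conjCharacterL2 : H → Lp ℂ 2 (dualHaar H)) := by
  classical
  rw [orthonormal_iff_ite]
  intro i j
  have hunit : ∀ (h : H) (ξ : DualGroup H),
      pairing h ξ * (starRingEnd ℂ) (pairing h ξ) = 1 := by
    intro h ξ
    rw [Complex.mul_conj, Complex.normSq_eq_norm_sq]
    simp [pairing, Circle.norm_coe]
  unfold conjCharacterL2
  rw [ContinuousMap.inner_toLp (dualHaar H) (conjCharacter i) (conjCharacter j)]
  split_ifs with hij
  · subst hij
    have h1 : ∀ ξ : DualGroup H,
        conjCharacter i ξ * (starRingEnd ℂ) (conjCharacter i ξ) = 1 := by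
      intro ξ
      have := hunit i ξ
      simpa [conjCharacter, mul_comm] using this
    simp [h1]
  · obtain ⟨ζ, hζ⟩ := exists_pairing_ne_one (H := H) (h := i - j) (sub_ne_zero.mpr hij)
    have hpr : ∀ ξ : DualGroup H,
        conjCharacter j ξ * (starRingEnd ℂ) (conjCharacter i ξ) = pairing (i - j) ξ := by
      intro ξ
      have h2 : pairing (i - j) ξ * pairing j ξ = pairing i ξ := by
        simp only [pairing]
        rw [← Circle.coe_mul, ← map_mul, ← ofAdd_add, sub_add_cancel]
      have h3 := hunit j ξ
      calc conjCharacter j ξ * (starRingEnd ℂ) (conjCharacter i ξ)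
          = (starRingEnd ℂ) (pairing j ξ) * pairing i ξ := by simp [conjCharacter]
        _ = pairing (i - j) ξ * (pairing j ξ * (starRingEnd ℂ) (pairing j ξ)) := by
            rw [← h2]; ring
        _ = pairing (i - j) ξ := by rw [h3, mul_one]
    simp only [hpr]
    have h4 : ∫ ξ, pairing (i - j) (ζ * ξ) ∂(dualHaar H) = ∫ ξ, pairing (i - j) ξ ∂(dualHaar H) :=
      integral_mul_left_eq_self (fun ξ => pairing (i - j) ξ) ζ
    have h5 : ∀ ξ, pairing (i - j) (ζ * ξ) = pairing (i - j) ζ * pairing (i - j) ξ := by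
      intro ξ
      exact Circle.coe_mul _ _
    simp only [h5, integral_const_mul] at h4
    have h6 : (pairing (i - j) ζ - 1) * ∫ ξ, pairing (i - j) ξ ∂(dualHaar H) = 0 := by
      rw [sub_mul, h4, one_mul, sub_self]
    exact (mul_eq_zero.mp h6).resolve_left (sub_ne_zero.mpr hζ)

/-- The Fourier transform `x̂ = ∑ h, x h • conj (h, ·)` of `x ∈ ℓ²(H)`, the series converging in
`L²(Ĥ)`: the isometry from `ℓ²(H)` into `L²(Ĥ)` that extends the Fourier transform of `ℓ¹(H)`. -/
def fourierL2 : lp (fun _ : H => ℂ) 2 →ₗᵢ[ℂ] Lp ℂ 2 (dualHaar H) :=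
  (orthonormal_conjCharacterL2 (H := H)).orthogonalFamily.linearIsometry

end Fourier

/-! ### Frames and Riesz bases -/

/-- A continuous frame `ψ : Ω → ℋ` with respect to the measure `μ`. (Mathlib's inner product is
linear in the second variable: `inner ℂ (ψ w) x` is `⟨x, ψ w⟩` when inner products are linear in
the first one.) -/
def IsContinuousFrame {Ω ℋ : Type*} [MeasurableSpace Ω] [NormedAddCommGroup ℋ]
    [InnerProductSpace ℂ ℋ] (μ : Measure Ω) (ψ : Ω → ℋ) : Prop :=
  (∀ x : ℋ, Measurable fun w => inner ℂ (ψ w) x) ∧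
  ∃ A B : ℝ, 0 < A ∧ A ≤ B ∧ ∀ x : ℋ,
    ENNReal.ofReal (A * ‖x‖ ^ 2) ≤ ∫⁻ w, ‖inner ℂ (ψ w) x‖ₑ ^ 2 ∂μ ∧
    ∫⁻ w, ‖inner ℂ (ψ w) x‖ₑ ^ 2 ∂μ ≤ ENNReal.ofReal (B * ‖x‖ ^ 2)

open Classical in
/-- The family `x` is a Riesz basis of the subspace `V`: it is the image of the canonical
orthonormal basis of `ℓ²(ι)` under a bounded and boundedly invertible linear map onto `V`. -/
def IsRieszBasis {ι E : Type*} [NormedAddCommGroup E] [InnerProductSpace ℂ E]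
    (x : ι → E) (V : Submodule ℂ E) : Prop :=
  ∃ e : lp (fun _ : ι => ℂ) 2 ≃L[ℂ] V, ∀ i, (e (lp.single 2 i (1 : ℂ)) : E) = x i

/-! ### Unitary representations and the spaces they generate -/

/-- A (weakly continuous) unitary representation of the topological group `G` on `ℋ`. -/
structure UnitaryRepresentation (G ℋ : Type*) [AddCommGroup G] [TopologicalSpace G]
    [NormedAddCommGroup ℋ] [InnerProductSpace ℂ ℋ] where
  /-- the unitary operators `U(t)` -/
  toFun : G → (ℋ ≃ₗᵢ[ℂ] ℋ)
  map_zero : ∀ x, toFun 0 x = x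
  map_add : ∀ s t x, toFun (s + t) x = toFun s (toFun t x)
  continuous_inner : ∀ x y : ℋ, Continuous fun t => inner ℂ (toFun t x) y

instance unitaryRepresentationCoeFun (G ℋ : Type*) [AddCommGroup G] [TopologicalSpace G]
    [NormedAddCommGroup ℋ] [InnerProductSpace ℂ ℋ] :
    CoeFun (UnitaryRepresentation G ℋ) fun _ => G → (ℋ ≃ₗᵢ[ℂ] ℋ) :=
  ⟨UnitaryRepresentation.toFun⟩

section Spaces

variable {G ℋ : Type*} [AddCommGroup G] [TopologicalSpace G]
  [NormedAddCommGroup ℋ] [InnerProductSpace ℂ ℋ]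

/-- The subspace `ℋ_Φ = {∑ n, ∑ h ∈ H, x n h • U(h) (Φ n) | x n ∈ ℓ²(H)}` of `ℋ`. -/
def generatedSpace (U : UnitaryRepresentation G ℋ) (H : AddSubgroup G) {N : ℕ}
    (Φ : Fin N → ℋ) : Submodule ℂ ℋ where
  carrier := {f | ∃ x : Fin N → lp (fun _ : H => ℂ) 2,
    HasSum (fun p : Fin N × H => x p.1 p.2 • U (p.2 : G) (Φ p.1)) f}
  zero_mem' := ⟨0, by simp⟩
  add_mem' := by
    rintro f g ⟨x, hx⟩ ⟨y, hy⟩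
    exact ⟨x + y, by simpa [add_smul] using hx.add hy⟩
  smul_mem' := by
    rintro c f ⟨x, hx⟩
    exact ⟨c • x, by simpa [mul_smul] using hx.const_smul c⟩

/-- The linear map `f ↦ F_f`, where `F_f(t) = ⟨f, U(t) ϕ⟩` (linear in `f`). -/
def analysisMap (U : UnitaryRepresentation G ℋ) (ϕ : ℋ) : ℋ →ₗ[ℂ] (G → ℂ) where
  toFun f := fun t => inner ℂ (U t ϕ) f
  map_add' f g := by funext t; simp
  map_smul' c f := by funext t; simp

/-- The space `ℋ_{U,ϕ,Φ}` of the functions `F_f : G → ℂ`, for `f ∈ ℋ_Φ`. -/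
def samplingSpace (U : UnitaryRepresentation G ℋ) (ϕ : ℋ) (H : AddSubgroup G) {N : ℕ}
    (Φ : Fin N → ℋ) : Submodule ℂ (G → ℂ) :=
  (generatedSpace U H Φ).map (analysisMap U ϕ)

/-- The classes in `L²(G)` of the functions that belong to the space `V`. -/
def classesInL2 [MeasurableSpace G] (μ : Measure G) (V : Submodule ℂ (G → ℂ)) :
    Submodule ℂ (Lp ℂ 2 μ) where
  carrier := {u | ∃ F ∈ V, u =ᵐ[μ] F}
  zero_mem' := ⟨0, V.zero_mem, Lp.coeFn_zero _ _ _⟩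
  add_mem' := by
    rintro u v ⟨F, hF, hu⟩ ⟨K, hK, hv⟩
    exact ⟨F + K, V.add_mem hF hK, (Lp.coeFn_add u v).trans (hu.add hv)⟩
  smul_mem' := by
    rintro c u ⟨F, hF, hu⟩
    exact ⟨c • F, V.smul_mem c hF, (Lp.coeFn_smul c u).trans (hu.const_smul c)⟩

end Spaces

end

noncomputable section

/-! As `U` is a representation, `⟨U(h)φ, U(t)ϕ⟩` depends only on `t - h`. Hence for `f = ∑ x_n(h)
U(h)φ_n` the samples of `F_f` at `H` are the sum over `n` of the convolutions of `x_n` with `a_n(s)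
= ⟨φ_n, U(s)ϕ⟩`. Each `a_n` is in `ℓ²(H)`, being up to conjugation and reflection the Riesz
representer of a bounded functional. The Fourier transform is unitary from `ℓ²(H)` onto `L²(Ĥ)`, and
it turns the sample at `t` into the integral of `(t, ξ) ∑ â_n x̂_n` (`inner_eq_integral`).

(i) Given two generators, pick `u, v` in `L²(Ĥ)`, not both zero, with `â₁ u + â₂ v = 0`. By
surjectivity of the transform they come from `ℓ²` coefficients, which give `f ≠ 0` with all samples
zero. The lower frame bound makes `f ↦ F_f` injective, so sampling is not injective.

(ii) Multiplication by `â` is now an automorphism of `L²(Ĥ)`, so the samples are `ℓ²` coordinates on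
`ℋ_Φ` (`exists_sample_coordinates`): some isomorphism `W` sends `c` to the vector with samples `c`.
By covariance `W δ_t = U(t) W δ_0`, so `f = ∑ F_f(t) U(t) W δ_0`, and `S` is the function of `W
δ_0`. The bound `|F_f(s)| ≤ ‖ϕ‖ ‖f‖` carries this expansion to uniform convergence, and the analysis
operator of the frame carries it, with the Riesz basis, to `L²(G)`. -/

open Classical in
/-- The canonical unit vectors of `ℓ²(ι)`. -/
abbrev lpUnit {ι : Type*} (i : ι) : lp (fun _ : ι => ℂ) 2 := lp.single 2 i (1 : ℂ)

theorem lpUnit_apply_self {ι : Type*} (i : ι) : lpUnit i i = 1 := by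
  classical
  exact lp.single_apply_self _ _ _

theorem lpUnit_apply_of_ne {ι : Type*} {i j : ι} (h : j ≠ i) : lpUnit i j = 0 := by
  classical
  exact lp.single_apply_ne _ _ _ h

theorem inner_lpUnit_left {ι : Type*} (i : ι) (x : lp (fun _ : ι => ℂ) 2) :
    inner ℂ (lpUnit i) x = x i := by
  classical
  rw [lp.inner_single_left]
  simp

theorem hasSum_smul_lpUnit {ι : Type*} (x : lp (fun _ : ι => ℂ) 2) :
    HasSum (fun i => x i • lpUnit i) x := by
  classical
  convert! lp.hasSum_single (p := 2) (by norm_num) x with i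
  rw [← lp.single_smul, smul_eq_mul, mul_one]

theorem ext_lpUnit {ι E : Type*} [NormedAddCommGroup E] [NormedSpace ℂ E]
    {L K : lp (fun _ : ι => ℂ) 2 →L[ℂ] E} (h : ∀ i, L (lpUnit i) = K (lpUnit i)) : L = K := by
  ext x
  have hL := L.hasSum (hasSum_smul_lpUnit x)
  have hK := K.hasSum (hasSum_smul_lpUnit x)
  simp only [map_smul, h] at hL hK
  exact hL.unique hK

/-! ### Plancherel and inversion on the dual of a discrete group -/

section FourierTransform

variable {H : Type*} [AddCommGroup H] [TopologicalSpace H]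

theorem pairing_add (g h : H) (ξ : DualGroup H) :
    pairing (g + h) ξ = pairing g ξ * pairing h ξ := by
  simp only [pairing]
  rw [← Circle.coe_mul, ← map_mul, ← ofAdd_add]

theorem pairing_zero (ξ : DualGroup H) : pairing (0 : H) ξ = 1 := by
  simp [pairing]

theorem pairing_neg (h : H) (ξ : DualGroup H) :
    pairing (-h) ξ = (starRingEnd ℂ) (pairing h ξ) := by
  simp only [pairing]
  rw [ofAdd_neg, map_inv, Circle.coe_inv_eq_conj]

theorem norm_pairing (h : H) (ξ : DualGroup H) : ‖pairing h ξ‖ = 1 :=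
  Circle.norm_coe _

theorem continuous_pairing (h : H) : Continuous (pairing h : DualGroup H → ℂ) := by
  simpa [conjCharacter, Function.comp_def] using
    Complex.continuous_conj.comp (conjCharacter h).continuous

theorem conjCharacter_apply (h : H) (ξ : DualGroup H) :
    conjCharacter h ξ = (starRingEnd ℂ) (pairing h ξ) := rfl

theorem conjCharacter_add (g h : H) :
    conjCharacter (g + h) = conjCharacter g * conjCharacter h := by
  ext ξ
  simp [conjCharacter_apply, pairing_add]

theorem star_conjCharacter (h : H) : star (conjCharacter h) = conjCharacter (-h) := by
  ext ξ
  simp [conjCharacter_apply, pairing_neg]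

variable (H) in
/-- The star subalgebra of `C(Ĥ, ℂ)` generated by the characters. -/
def characterSubalgebra : StarSubalgebra ℂ C(DualGroup H, ℂ) where
  toSubalgebra := Algebra.adjoin ℂ (Set.range (conjCharacter : H → _))
  star_mem' := by
    change Algebra.adjoin ℂ (Set.range (conjCharacter : H → _)) ≤
      star (Algebra.adjoin ℂ (Set.range (conjCharacter : H → _)))
    refine Algebra.adjoin_le ?_
    rintro - ⟨h, rfl⟩
    exact Algebra.subset_adjoin ⟨-h, (star_conjCharacter h).symm⟩

/-- The characters form a group under multiplication, so the algebra they generate is just their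
linear span. -/
theorem characterSubalgebra_coe :
    Subalgebra.toSubmodule (characterSubalgebra H).toSubalgebra =
      Submodule.span ℂ (Set.range (conjCharacter : H → C(DualGroup H, ℂ))) := by
  apply Algebra.adjoin_eq_span_of_subset
  refine Set.Subset.trans ?_ Submodule.subset_span
  intro x hx
  refine Submonoid.closure_induction (fun _ => id) ⟨0, ?_⟩ ?_ hx
  · ext ξ
    simp [conjCharacter_apply, pairing_zero]
  · rintro _ _ _ _ ⟨m, rfl⟩ ⟨n, rfl⟩
    exact ⟨m + n, conjCharacter_add m n⟩

theorem characterSubalgebra_separatesPoints :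
    (characterSubalgebra H).SeparatesPoints := by
  intro ξ ζ hne
  obtain ⟨h, hh⟩ : ∃ h : Multiplicative H, ξ h ≠ ζ h := by
    by_contra! hcon
    exact hne (ContinuousMonoidHom.ext hcon)
  refine ⟨_, ⟨conjCharacter h.toAdd, Algebra.subset_adjoin ⟨_, rfl⟩, rfl⟩, fun heq => hh ?_⟩
  have h1 := (starRingEnd ℂ).injective heq
  exact Circle.ext h1

variable [DiscreteTopology H]

instance dualHaarRegular : (dualHaar H).Regular := by
  unfold dualHaar; infer_instance

/-- The characters are total in `L²(Ĥ)`. -/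
theorem span_conjCharacterL2_closure_eq_top :
    (Submodule.span ℂ (Set.range (conjCharacterL2 : H → _))).topologicalClosure = ⊤ := by
  have h1 : (Submodule.span ℂ
      (Set.range (conjCharacter : H → C(DualGroup H, ℂ)))).topologicalClosure = ⊤ := by
    rw [← characterSubalgebra_coe]
    exact congr_arg (Subalgebra.toSubmodule <| StarSubalgebra.toSubalgebra ·)
      (ContinuousMap.starSubalgebra_topologicalClosure_eq_top_of_separatesPoints
        (characterSubalgebra H) characterSubalgebra_separatesPoints)
  convert! (ContinuousMap.toLp_denseRange ℂ (dualHaar H) ℂ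
    (p := 2) (by norm_num)).topologicalClosure_map_submodule h1
  rw [Submodule.map_span, ← Set.range_comp]
  rfl

theorem fourierL2_lpUnit (h : H) : fourierL2 (lpUnit h) = conjCharacterL2 h := by
  simp [fourierL2, OrthogonalFamily.linearIsometry_apply_single]

/-- The range of an isometry on a complete space is closed, and it contains the characters, which
are total by Stone–Weierstrass. -/
theorem fourierL2_surjective : Function.Surjective (fourierL2 (H := H)) := by
  have h1 : LinearMap.range (fourierL2 (H := H)).toLinearMap = ⊤ := by
    rw [eq_top_iff, ← span_conjCharacterL2_closure_eq_top]
    refine Submodule.topologicalClosure_minimal _ ?_ ?_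
    · rw [Submodule.span_le]
      rintro - ⟨h, rfl⟩
      exact ⟨_, fourierL2_lpUnit h⟩
    · exact (fourierL2 (H := H)).isometry.isClosedEmbedding.isClosed_range
  exact LinearMap.range_eq_top.mp h1

variable (H) in
/-- The Fourier transform as a unitary operator from `ℓ²(H)` onto `L²(Ĥ)`. -/
def fourierEquiv : lp (fun _ : H => ℂ) 2 ≃ₗᵢ[ℂ] Lp ℂ 2 (dualHaar H) :=
  LinearIsometryEquiv.ofSurjective fourierL2 fourierL2_surjective

theorem coeFn_conjCharacterL2 (h : H) :
    conjCharacterL2 h =ᵐ[dualHaar H] fun ξ => (starRingEnd ℂ) (pairing h ξ) :=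
  ContinuousMap.coeFn_toLp _ _

theorem inner_conjCharacterL2 (h : H) (w : Lp ℂ 2 (dualHaar H)) :
    inner ℂ (conjCharacterL2 h) w = ∫ ξ, pairing h ξ * w ξ ∂(dualHaar H) := by
  rw [L2.inner_def]
  refine integral_congr_ae ?_
  filter_upwards [coeFn_conjCharacterL2 h] with ξ hξ
  rw [hξ]
  simp [mul_comm]

/-- Fourier inversion. -/
theorem integral_pairing_mul_fourierL2 (h : H) (x : lp (fun _ : H => ℂ) 2) :
    ∫ ξ, pairing h ξ * fourierL2 x ξ ∂(dualHaar H) = x h := by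
  rw [← inner_conjCharacterL2, ← fourierL2_lpUnit, LinearIsometry.inner_map_map,
    inner_lpUnit_left]

/-- A functional on `ℓ²(H)` that acts on the unit vectors as the convolution with `a` is given by
the product of the Fourier transforms. -/
theorem apply_eq_integral_of_single {a : lp (fun _ : H => ℂ) 2} {t : H}
    (L : lp (fun _ : H => ℂ) 2 →L[ℂ] ℂ) (hL : ∀ h, L (lpUnit h) = a (t - h))
    (x : lp (fun _ : H => ℂ) 2) :
    L x = ∫ ξ, pairing t ξ * (fourierL2 a ξ * fourierL2 x ξ) ∂(dualHaar H) := by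
  -- A product of two `L²` functions is only in `L¹`, so the right side is built as a bounded
  -- functional: pairing with this `L²` function.
  have hmem : MemLp (fun ξ => pairing t ξ * fourierL2 a ξ) 2 (dualHaar H) := by
    refine (Lp.memLp (fourierL2 a)).of_le
      ((continuous_pairing t).aestronglyMeasurable.mul (Lp.aestronglyMeasurable _)) ?_
    filter_upwards with ξ
    rw [norm_mul, norm_pairing, one_mul]
  let K : lp (fun _ : H => ℂ) 2 →L[ℂ] ℂ :=
    ((ContinuousLinearMap.mul ℂ ℂ).lpPairing (dualHaar H) 2 2 (hmem.toLp _)).comp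
      (fourierL2 (H := H)).toContinuousLinearMap
  have hK : ∀ y, K y = ∫ ξ, pairing t ξ * (fourierL2 a ξ * fourierL2 y ξ) ∂(dualHaar H) := by
    intro y
    change (ContinuousLinearMap.mul ℂ ℂ).lpPairing (dualHaar H) 2 2 (hmem.toLp _)
      (fourierL2 y) = _
    rw [ContinuousLinearMap.lpPairing_eq_integral]
    refine integral_congr_ae ?_
    filter_upwards [hmem.coeFn_toLp] with ξ hξ
    rw [hξ]
    simp [mul_assoc]
  -- On unit vectors both sides agree by Fourier inversion at `t - h`.
  have hLK : L = K := by
    refine ext_lpUnit fun h => ?_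
    rw [hL, hK, ← integral_pairing_mul_fourierL2, fourierL2_lpUnit]
    refine integral_congr_ae ?_
    filter_upwards [coeFn_conjCharacterL2 h] with ξ hξ
    rw [hξ, ← pairing_neg, sub_eq_add_neg, pairing_add]
    ring
  rw [hLK, hK]

end FourierTransform

/-! ### Multiplication operators on `L²` -/

section Multiplication

variable {α : Type*} [MeasurableSpace α] {ν : Measure α}

/-- Multiplication by an essentially bounded function, as an operator on `L²`. -/
def mulL2 (m : Lp ℂ ∞ ν) : Lp ℂ 2 ν →L[ℂ] Lp ℂ 2 ν :=
  (ContinuousLinearMap.mul ℂ ℂ).holderL ν ∞ 2 2 m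

theorem coeFn_mulL2 (m : Lp ℂ ∞ ν) (w : Lp ℂ 2 ν) : mulL2 m w =ᵐ[ν] fun ξ => m ξ * w ξ := by
  simpa [mulL2] using (ContinuousLinearMap.mul ℂ ℂ).coeFn_holder (r := 2) m w

theorem mulL2_mulL2 {m k : Lp ℂ ∞ ν} (h : ∀ᵐ ξ ∂ν, m ξ * k ξ = 1) (w : Lp ℂ 2 ν) :
    mulL2 m (mulL2 k w) = w := by
  refine Lp.ext ?_
  filter_upwards [coeFn_mulL2 m (mulL2 k w), coeFn_mulL2 k w, h] with ξ h1 h2 h3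
  rw [h1, h2, ← mul_assoc, h3, one_mul]

/-- A bounded function that is bounded away from zero has a bounded inverse. -/
theorem memLp_top_inv {m : α → ℂ} (hm : AEStronglyMeasurable m ν)
    (hpos : 0 < essInf (fun ξ => ‖m ξ‖ₑ) ν) :
    MemLp (fun ξ => (m ξ)⁻¹) ∞ ν ∧ ∀ᵐ ξ ∂ν, m ξ ≠ 0 := by
  have h0 : ∀ᵐ ξ ∂ν, m ξ ≠ 0 := by
    filter_upwards [ae_essInf_le (f := fun ξ => ‖m ξ‖ₑ)] with ξ hξ h
    simp [h] at hξ
    exact hpos.ne' hξ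
  refine ⟨⟨hm.aemeasurable.inv.aestronglyMeasurable, ?_⟩, h0⟩
  rw [eLpNorm_exponent_top]
  refine (eLpNormEssSup_le_of_ae_enorm_bound
    (C := (essInf (fun ξ => ‖m ξ‖ₑ) ν)⁻¹) ?_).trans_lt (ENNReal.inv_lt_top.mpr hpos)
  filter_upwards [ae_essInf_le (f := fun ξ => ‖m ξ‖ₑ), h0] with ξ hξ h
  rw [enorm_inv h]
  exact ENNReal.inv_le_inv.mpr hξ

/-- Multiplication by a bounded function with a bounded inverse is an automorphism of `L²`. -/
theorem exists_mulL2_equiv {m : α → ℂ} (hm : MemLp m ∞ ν)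
    (hpos : 0 < essInf (fun ξ => ‖m ξ‖ₑ) ν) :
    ∃ M : Lp ℂ 2 ν ≃L[ℂ] Lp ℂ 2 ν, ∀ w, M w =ᵐ[ν] fun ξ => m ξ * w ξ := by
  obtain ⟨hinv, h0⟩ := memLp_top_inv hm.1 hpos
  have h1 : ∀ᵐ ξ ∂ν, hm.toLp m ξ * hinv.toLp _ ξ = 1 := by
    filter_upwards [hm.coeFn_toLp, hinv.coeFn_toLp, h0] with ξ ha hb hc
    rw [ha, hb, mul_inv_cancel₀ hc]
  refine ⟨ContinuousLinearEquiv.equivOfInverse (mulL2 (hm.toLp m)) (mulL2 (hinv.toLp _))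
    (mulL2_mulL2 ?_) (mulL2_mulL2 h1), fun w => ?_⟩
  · filter_upwards [h1] with ξ h
    rw [mul_comm, h]
  · change mulL2 (hm.toLp m) w =ᵐ[ν] _
    filter_upwards [coeFn_mulL2 (hm.toLp m) w, hm.coeFn_toLp] with ξ ha hb
    rw [ha, hb]

end Multiplication

theorem Memℓp.comp_equiv {A B : Type*} {f : B → ℂ} (hf : Memℓp f 2) (σ : A ≃ B) :
    Memℓp (fun a => f (σ a)) 2 :=
  (memℓp_gen_iff (by norm_num)).mpr
    (σ.summable_iff.mpr ((memℓp_gen_iff (by norm_num)).mp hf))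

/-! ### Embeddings of `ℓ²` spaces along injections of index sets -/

section CoordinateEmbedding

variable {A B : Type*}

theorem orthonormal_lpUnit_comp {j : A → B} (hj : Function.Injective j) :
    Orthonormal ℂ fun a => lpUnit (j a) := by
  classical
  rw [orthonormal_iff_ite]
  intro a b
  rw [lp.inner_single_left, lp.single_apply, Pi.single_apply]
  simp [hj.eq_iff]

/-- The isometry `ℓ²(A) → ℓ²(B)` induced by an injection `A → B`. -/
def lpEmbedding (j : A → B) (hj : Function.Injective j) :
    lp (fun _ : A => ℂ) 2 →ₗᵢ[ℂ] lp (fun _ : B => ℂ) 2 :=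
  (orthonormal_lpUnit_comp hj).orthogonalFamily.linearIsometry

variable {j : A → B} (hj : Function.Injective j)

theorem lpEmbedding_lpUnit (a : A) :
    lpEmbedding j hj (lpUnit a) = lpUnit (j a) := by
  simp [lpEmbedding, OrthogonalFamily.linearIsometry_apply_single]

theorem lpEmbedding_apply_of_notMem_range (x : lp (fun _ : A => ℂ) 2) {b : B}
    (hb : b ∉ Set.range j) : lpEmbedding j hj x b = 0 := by
  classical
  let L : lp (fun _ : A => ℂ) 2 →L[ℂ] ℂ :=
    (innerSL ℂ (lpUnit b : lp (fun _ : B => ℂ) 2)).comp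
      (lpEmbedding j hj).toContinuousLinearMap
  have hL : ∀ y, L y = lpEmbedding j hj y b := by
    intro y
    change inner ℂ (lpUnit b) (lpEmbedding j hj y) = _
    rw [inner_lpUnit_left]
  have h0 : L = 0 := by
    refine ext_lpUnit fun a => ?_
    rw [hL, lpEmbedding_lpUnit, lp.single_apply]
    exact Pi.single_eq_of_ne (fun h => hb ⟨a, h.symm⟩) _
  rw [← hL, h0]
  rfl

theorem lpEmbedding_apply_self (x : lp (fun _ : A => ℂ) 2) (a : A) :
    lpEmbedding j hj x (j a) = x a := by
  have h1 := (lpEmbedding j hj).inner_map_map (lpUnit a) x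
  rwa [lpEmbedding_lpUnit, inner_lpUnit_left, inner_lpUnit_left] at h1

theorem lpEmbedding_surjective (hs : Function.Surjective j) :
    Function.Surjective (lpEmbedding j hj) := by
  intro y
  have hcl : IsClosed (Set.range (lpEmbedding j hj)) :=
    (lpEmbedding j hj).isometry.isClosedEmbedding.isClosed_range
  refine hcl.mem_of_tendsto (hasSum_smul_lpUnit y)
    (Eventually.of_forall fun s => ?_)
  change _ ∈ LinearMap.range (lpEmbedding j hj).toLinearMap
  refine Submodule.sum_mem _ fun b _ => ?_
  obtain ⟨a, rfl⟩ := hs b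
  refine ⟨y (j a) • lpUnit a, ?_⟩
  change lpEmbedding j hj _ = _
  rw [map_smul, lpEmbedding_lpUnit]

end CoordinateEmbedding

/-! ### Samples of a function as a Fourier multiplier -/

section Sampling

variable {G ℋ : Type*} [AddCommGroup G] [TopologicalSpace G]
  [NormedAddCommGroup ℋ] [InnerProductSpace ℂ ℋ]
  (U : UnitaryRepresentation G ℋ) (ϕ : ℋ) (H : AddSubgroup G)

theorem inner_translate (s t : G) (x : ℋ) :
    (inner ℂ (U s ϕ) (U t x) : ℂ) = inner ℂ (U (s - t) ϕ) x := by
  have h : U s ϕ = U t (U (s - t) ϕ) := by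
    rw [← U.map_add, add_sub_cancel]
  rw [h, LinearIsometryEquiv.inner_map_map]

theorem analysisMap_apply (f : ℋ) (t : G) : analysisMap U ϕ f t = inner ℂ (U t ϕ) f := rfl

variable {H}

/-- The samples at `H` of a function `⟨φ, U(·) ϕ⟩` are square summable if `U(h) φ`, `h ∈ H`, is a
Bessel sequence. -/
theorem memℓp_sample [CompleteSpace ℋ] {φ : ℋ} (E : lp (fun _ : H => ℂ) 2 →L[ℂ] ℋ)
    (hE : ∀ h : H, E (lpUnit h) = U (h : G) φ) :
    Memℓp (fun s : H => (inner ℂ (U (s : G) ϕ) φ : ℂ)) 2 := by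
  -- Representer of `x ↦ ⟨E x, ϕ⟩`; its entry at `-h` is the conjugate of the sample at `h`.
  let y := (InnerProductSpace.toDual ℂ (lp (fun _ : H => ℂ) 2)).symm ((innerSL ℂ ϕ).comp E)
  have hy : ∀ h : H, ‖y (-h)‖ = ‖(inner ℂ (U (h : G) ϕ) φ : ℂ)‖ := by
    intro h
    have h1 : inner ℂ y (lpUnit (-h)) = inner ℂ ϕ (U ((-h : H) : G) φ) := by
      rw [InnerProductSpace.toDual_symm_apply]
      simp [hE]
    have h2 := inner_translate U ϕ 0 ((-h : H) : G) φ
    rw [U.map_zero] at h2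
    rw [h2, ← inner_conj_symm, inner_lpUnit_left] at h1
    have h3 := congrArg norm h1
    simpa using h3
  refine (memℓp_gen_iff (by norm_num)).mpr ?_
  simpa [hy] using (memℓp_gen_iff (by norm_num)).mp ((lp.memℓp y).comp_equiv (Equiv.neg H))

/-- The samples at `H` of the function associated with `∑ h, x h • U(h) φ`, in terms of Fourier
transforms. -/
theorem inner_eq_integral [DiscreteTopology H] {φ : ℋ} (E : lp (fun _ : H => ℂ) 2 →L[ℂ] ℋ)
    (hE : ∀ h : H, E (lpUnit h) = U (h : G) φ) {a : lp (fun _ : H => ℂ) 2}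
    (ha : ∀ s : H, a s = inner ℂ (U (s : G) ϕ) φ) (x : lp (fun _ : H => ℂ) 2) (t : H) :
    inner ℂ (U (t : G) ϕ) (E x) =
      ∫ ξ, pairing t ξ * (fourierL2 a ξ * fourierL2 x ξ) ∂(dualHaar H) := by
  refine apply_eq_integral_of_single ((innerSL ℂ (U (t : G) ϕ)).comp E) (fun h => ?_) x
  rw [ContinuousLinearMap.comp_apply, innerSL_apply_apply, hE, inner_translate, ha, AddSubgroup.coe_sub]

/-- If the Fourier transform of the samples of the generator is bounded and bounded away from zero,
the samples at `H` are coordinates on the generated space. -/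
theorem exists_sample_coordinates [DiscreteTopology H] {V : Submodule ℂ ℋ}
    (E : lp (fun _ : H => ℂ) 2 ≃L[ℂ] V) {a : lp (fun _ : H => ℂ) 2}
    (hE : ∀ (x : lp (fun _ : H => ℂ) 2) (t : H), inner ℂ (U (t : G) ϕ) (E x : ℋ) =
      ∫ ξ, pairing t ξ * (fourierL2 a ξ * fourierL2 x ξ) ∂(dualHaar H))
    (hbdd : MemLp (fourierL2 a) ∞ (dualHaar H))
    (hpos : 0 < essInf (fun ξ => ‖fourierL2 a ξ‖ₑ) (dualHaar H)) :
    ∃ W : lp (fun _ : H => ℂ) 2 ≃L[ℂ] V,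
      ∀ (c : lp (fun _ : H => ℂ) 2) (t : H), inner ℂ (U (t : G) ϕ) (W c : ℋ) = c t := by
  obtain ⟨M, hM⟩ := exists_mulL2_equiv hbdd hpos
  let 𝓕 := (fourierEquiv H).toContinuousLinearEquiv
  -- `C` is convolution with `a`: it takes coefficients to samples, so `E ∘ C⁻¹` takes samples to
  -- vectors.
  let C : lp (fun _ : H => ℂ) 2 ≃L[ℂ] lp (fun _ : H => ℂ) 2 := (𝓕.trans M).trans 𝓕.symm
  have hC : ∀ x, fourierL2 (C x) = M (fourierL2 x) := fun x =>
    (fourierEquiv H).apply_symm_apply (M (fourierL2 x))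
  refine ⟨C.symm.trans E, fun c t => ?_⟩
  obtain ⟨x, rfl⟩ := C.surjective c
  rw [ContinuousLinearEquiv.trans_apply, C.symm_apply_apply, hE,
    ← integral_pairing_mul_fourierL2 t (C x), hC]
  refine integral_congr_ae ?_
  filter_upwards [hM (fourierL2 x)] with ξ hξ
  rw [hξ]

end Sampling

/-! ### The analysis operator of a continuous frame -/

section Frame

variable {ℋ : Type*} [NormedAddCommGroup ℋ] [InnerProductSpace ℂ ℋ]

/-- The analysis operator of a continuous frame, as an operator into `L²`. -/
theorem IsContinuousFrame.exists_analysis {Ω : Type*} [MeasurableSpace Ω] {ν : Measure Ω}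
    {ψ : Ω → ℋ} (h : IsContinuousFrame ν ψ) :
    ∃ T : ℋ →L[ℂ] Lp ℂ 2 ν, (∃ K, AntilipschitzWith K T) ∧
      ∀ x, T x =ᵐ[ν] fun w => inner ℂ (ψ w) x := by
  obtain ⟨hmeas, A, B, hA, hAB, hb⟩ := h
  have hB : 0 < B := hA.trans_le hAB
  have hsq : ∀ x, eLpNorm (fun w => (inner ℂ (ψ w) x : ℂ)) 2 ν ^ 2 =
      ∫⁻ w, ‖(inner ℂ (ψ w) x : ℂ)‖ₑ ^ 2 ∂ν := by
    intro x
    have := eLpNorm_nnreal_pow_eq_lintegral (p := 2) (μ := ν)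
      (f := fun w => (inner ℂ (ψ w) x : ℂ)) (by norm_num)
    simpa using this
  have hmem : ∀ x, MemLp (fun w => (inner ℂ (ψ w) x : ℂ)) 2 ν := by
    intro x
    refine ⟨(hmeas x).aestronglyMeasurable, ?_⟩
    have h1 := (hsq x).trans_le (hb x).2
    have h2 : eLpNorm (fun w => (inner ℂ (ψ w) x : ℂ)) 2 ν ^ 2 < ∞ :=
      h1.trans_lt ENNReal.ofReal_lt_top
    exact (ENNReal.pow_lt_top_iff.mp h2).resolve_right (by norm_num)
  let T₀ : ℋ →ₗ[ℂ] Lp ℂ 2 ν :=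
    { toFun := fun x => (hmem x).toLp _
      map_add' := fun x y => by
        rw [← MemLp.toLp_add]
        exact MemLp.toLp_congr _ _ (Eventually.of_forall fun w => by simp)
      map_smul' := fun c x => by
        rw [RingHom.id_apply, ← MemLp.toLp_const_smul]
        exact MemLp.toLp_congr _ _ (Eventually.of_forall fun w => by simp) }
  have hnorm : ∀ x, ENNReal.ofReal (‖T₀ x‖ ^ 2) = ∫⁻ w, ‖(inner ℂ (ψ w) x : ℂ)‖ₑ ^ 2 ∂ν := by
    intro x
    rw [← hsq, ENNReal.ofReal_pow (norm_nonneg _), ofReal_norm, ← Lp.enorm_toLp (hf := hmem x)]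
    rfl
  have hupper : ∀ x, ‖T₀ x‖ ≤ √B * ‖x‖ := by
    intro x
    have h1 := (hnorm x).trans_le (hb x).2
    rw [ENNReal.ofReal_le_ofReal_iff (by positivity)] at h1
    refine le_of_sq_le_sq ?_ (by positivity)
    rwa [mul_pow, Real.sq_sqrt hB.le]
  have hlower : ∀ x, √A * ‖x‖ ≤ ‖T₀ x‖ := by
    intro x
    have h1 := (hb x).1.trans_eq (hnorm x).symm
    rw [ENNReal.ofReal_le_ofReal_iff (by positivity)] at h1
    refine le_of_sq_le_sq ?_ (norm_nonneg _)
    rwa [mul_pow, Real.sq_sqrt hA.le]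
  refine ⟨T₀.mkContinuous _ hupper, ⟨(√A)⁻¹.toNNReal, ?_⟩, fun x => (hmem x).coeFn_toLp⟩
  refine AddMonoidHomClass.antilipschitz_of_bound _ fun x => ?_
  rw [Real.coe_toNNReal _ (by positivity), inv_mul_eq_div, le_div_iff₀ (by positivity), mul_comm]
  exact hlower x

end Frame

/-! ### The sampling expansion from sample coordinates -/

section SamplingExpansion

variable {G ℋ : Type*} [AddCommGroup G] [TopologicalSpace G]
  [NormedAddCommGroup ℋ] [InnerProductSpace ℂ ℋ]
  {U : UnitaryRepresentation G ℋ} {ϕ : ℋ} {H : AddSubgroup G} {V : Submodule ℂ ℋ}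

/-- If the samples at `H` are coordinates on an invariant space, the dual basis is generated by one
vector. -/
theorem translate_eq_of_sample_coordinates (hV : ∀ (t : H), ∀ f ∈ V, U (t : G) f ∈ V)
    {W : lp (fun _ : H => ℂ) 2 ≃L[ℂ] V}
    (hW : ∀ (c : lp (fun _ : H => ℂ) 2) (t : H), inner ℂ (U (t : G) ϕ) (W c : ℋ) = c t) (t : H) :
    (W (lpUnit t) : ℋ) = U (t : G) (W (lpUnit 0)) := by
  obtain ⟨c, hc⟩ := W.surjective ⟨_, hV t _ (W (lpUnit 0)).2⟩
  have hc' : (W c : ℋ) = U (t : G) (W (lpUnit 0)) := congrArg Subtype.val hc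
  rw [← hc']
  congr 2
  -- The sample at `s` of a vector translated by `t` is its sample at `s - t`, and `δ_0(s - t) =
  -- δ_t(s)`.
  ext s
  have h1 := hW c s
  rw [hc', inner_translate, ← AddSubgroup.coe_sub, hW] at h1
  rw [← h1]
  by_cases hst : s = t
  · rw [hst, sub_self, lpUnit_apply_self, lpUnit_apply_self]
  · rw [lpUnit_apply_of_ne hst, lpUnit_apply_of_ne (sub_ne_zero.mpr hst)]

variable (U ϕ) in
theorem analysisMap_sub (f : ℋ) (s t : G) :
    analysisMap U ϕ f (s - t) = analysisMap U ϕ (U t f) s := by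
  rw [analysisMap_apply, analysisMap_apply, inner_translate]

theorem IsContinuousFrame.analysisMap_injective [MeasurableSpace G] {μ : Measure G}
    (hframe : IsContinuousFrame μ fun t : G => U t ϕ) :
    Function.Injective (analysisMap U ϕ) := by
  obtain ⟨T, ⟨K, hK⟩, hT⟩ := hframe.exists_analysis
  intro f g hfg
  refine hK.injective (Lp.ext ?_)
  filter_upwards [hT f, hT g] with t hf hg
  rw [hf, hg]
  exact congrFun hfg t

theorem norm_analysisMap_le (f : ℋ) (s : G) : ‖analysisMap U ϕ f s‖ ≤ ‖ϕ‖ * ‖f‖ := by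
  simpa [analysisMap_apply] using norm_inner_le_norm (𝕜 := ℂ) (U s ϕ) f

theorem hasSum_sample_coordinates (hV : ∀ (t : H), ∀ f ∈ V, U (t : G) f ∈ V)
    {W : lp (fun _ : H => ℂ) 2 ≃L[ℂ] V}
    (hW : ∀ (c : lp (fun _ : H => ℂ) 2) (t : H), inner ℂ (U (t : G) ϕ) (W c : ℋ) = c t)
    {f : ℋ} (hf : f ∈ V) :
    HasSum (fun t : H => analysisMap U ϕ f t • U (t : G) (W (lpUnit 0) : ℋ)) f := by
  obtain ⟨c, hc⟩ := W.surjective ⟨f, hf⟩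
  have hc' : (W c : ℋ) = f := congrArg Subtype.val hc
  have h1 := (V.subtypeL.comp W.toContinuousLinearMap).hasSum (hasSum_smul_lpUnit c)
  subst hc'
  convert! h1 using 2 with t
  rw [map_smul]
  change _ = c t • (W (lpUnit t) : ℋ)
  rw [← translate_eq_of_sample_coordinates hV hW t, ← hW c t]
  rfl

/-- The sampling expansion when the samples at `H` are coordinates on an invariant space. -/
theorem exists_sampling_function [CompleteSpace ℋ] [MeasurableSpace G] {μ : Measure G}
    (hframe : IsContinuousFrame μ fun t : G => U t ϕ)
    (hV : ∀ (t : H), ∀ f ∈ V, U (t : G) f ∈ V)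
    {W : lp (fun _ : H => ℂ) 2 ≃L[ℂ] V}
    (hW : ∀ (c : lp (fun _ : H => ℂ) 2) (t : H), inner ℂ (U (t : G) ϕ) (W c : ℋ) = c t) :
    ∃ S ∈ V.map (analysisMap U ϕ),
      (∀ F ∈ V.map (analysisMap U ϕ),
        (∀ s : G, HasSum (fun t : H => F t * S (s - t)) (F s)) ∧
        TendstoUniformly (fun (T : Finset H) (s : G) => ∑ t ∈ T, F t * S (s - t)) F atTop ∧
        Tendsto (fun T : Finset H =>
          eLpNorm (fun s : G => F s - ∑ t ∈ T, F t * S (s - t)) 2 μ) atTop (𝓝 0)) ∧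
      (∀ S' ∈ V.map (analysisMap U ϕ),
        (∀ F ∈ V.map (analysisMap U ϕ), ∀ s : G,
          HasSum (fun t : H => F t * S' (s - t)) (F s)) → S' = S) ∧
      ∃ hS : ∀ t : H, MemLp (fun s : G => S (s - t)) 2 μ,
        IsRieszBasis (fun t : H => (hS t).toLp (fun s : G => S (s - t)))
          (classesInL2 μ (V.map (analysisMap U ϕ))) := by
  obtain ⟨A, ⟨K, hK⟩, hA⟩ := hframe.exists_analysis
  have hA' : ∀ f, A f =ᵐ[μ] analysisMap U ϕ f := hA
  set g : ℋ := (W (lpUnit 0) : ℋ) with hg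
  have hS : ∀ t : H, (fun s : G => analysisMap U ϕ g (s - t)) = analysisMap U ϕ (U (t : G) g) :=
    fun t => funext fun s => analysisMap_sub U ϕ g s t
  have hsum := fun {f : ℋ} (hf : f ∈ V) => hasSum_sample_coordinates hV hW hf
  have hpartial : ∀ (f : ℋ) (T : Finset H) (s : G),
      ∑ t ∈ T, analysisMap U ϕ f t * analysisMap U ϕ g (s - t) =
        analysisMap U ϕ (∑ t ∈ T, analysisMap U ϕ f t • U (t : G) g) s := by
    intro f T s
    simp only [map_sum, map_smul, Finset.sum_apply, Pi.smul_apply, smul_eq_mul, analysisMap_sub]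
  refine ⟨analysisMap U ϕ g, ⟨g, (W (lpUnit 0)).2, rfl⟩, ?_, ?_, ?_⟩
  · rintro - ⟨f, hf, rfl⟩
    have hlim := hsum hf
    refine ⟨fun s => ?_, ?_, ?_⟩
    · have h1 := (innerSL ℂ (U s ϕ)).hasSum hlim
      refine h1.congr_fun ?_
      intro t
      rw [analysisMap_sub]
      simp [analysisMap_apply, hg]
    · rw [Metric.tendstoUniformly_iff]
      intro ε hε
      -- The `+ 1` avoids division by zero, as `ϕ` may vanish.
      have h1 := (Metric.tendsto_nhds.mp hlim) (ε / (‖ϕ‖ + 1)) (by positivity)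
      filter_upwards [h1] with T hT s
      rw [hpartial, dist_eq_norm, ← Pi.sub_apply, ← map_sub]
      rw [dist_comm, dist_eq_norm, lt_div_iff₀ (by positivity)] at hT
      refine (norm_analysisMap_le _ _).trans_lt (lt_of_le_of_lt ?_ hT)
      nlinarith [norm_nonneg (f - ∑ t ∈ T, analysisMap U ϕ f t • U (t : G) g)]
    · have h1 : Tendsto (fun T : Finset H =>
          ‖A (f - ∑ t ∈ T, analysisMap U ϕ f t • U (t : G) g)‖ₑ) atTop (𝓝 ‖A (f - f)‖ₑ) :=
        (continuous_enorm.tendsto _).comp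
          ((A.continuous.tendsto _).comp (tendsto_const_nhds.sub hlim))
      rw [sub_self, map_zero, enorm_zero] at h1
      refine h1.congr fun T => ?_
      rw [Lp.enorm_def]
      refine eLpNorm_congr_ae ((hA' _).trans (Eventually.of_forall fun s => ?_))
      simp only [hpartial, map_sub, Pi.sub_apply]
  · intro S' _ hexp
    funext s
    -- Apply the competing expansion to `S` itself: its samples are `δ_0`, so the series collapses
    -- to `S' s`.
    have h1 := hexp (analysisMap U ϕ g) ⟨g, (W (lpUnit 0)).2, rfl⟩ s
    have h2 : HasSum (fun t : H => analysisMap U ϕ g t * S' (s - t)) (S' s) := by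
      convert! hasSum_single (0 : H) (f := fun t : H => analysisMap U ϕ g t * S' (s - t)) ?_ using 1
      · rw [analysisMap_apply, hg, hW, lpUnit_apply_self, one_mul, AddSubgroup.coe_zero, sub_zero]
      · intro t ht
        rw [analysisMap_apply, hg, hW, lpUnit_apply_of_ne ht, zero_mul]
    exact h2.unique h1
  · have hmem : ∀ t : H, MemLp (fun s : G => analysisMap U ϕ g (s - t)) 2 μ := by
      intro t
      rw [hS]
      exact (memLp_congr_ae (hA' _)).mp (Lp.memLp _)
    refine ⟨hmem, ?_⟩
    let Q : lp (fun _ : H => ℂ) 2 →L[ℂ] Lp ℂ 2 μ :=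
      A.comp (V.subtypeL.comp W.toContinuousLinearMap)
    have hQ : ∀ c, Q c = A (W c) := fun c => rfl
    have hrange : classesInL2 μ (V.map (analysisMap U ϕ)) = Q.range := by
      ext u
      constructor
      · rintro ⟨-, ⟨f, hf, rfl⟩, hu⟩
        obtain ⟨c, hc⟩ := W.surjective ⟨f, hf⟩
        refine ⟨c, ?_⟩
        change A (W c) = u
        rw [hc]
        exact Lp.ext ((hA' f).trans hu.symm)
      · rintro ⟨c, rfl⟩
        exact ⟨_, ⟨W c, (W c).2, rfl⟩, hA' _⟩
    -- Being bounded below gives injectivity and closed range, hence an isomorphism onto the range.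
    have hanti : AntilipschitzWith _ Q :=
      hK.comp ((isometry_subtype_coe (s := (V : Set ℋ))).antilipschitz.comp W.antilipschitz)
    rw [hrange]
    refine ⟨Q.equivRange hanti.injective (hanti.isClosed_range Q.uniformContinuous), fun t => ?_⟩
    change A (W (lpUnit t)) = _
    rw [translate_eq_of_sample_coordinates hV hW]
    refine Lp.ext ((hA' _).trans ?_)
    refine EventuallyEq.trans ?_ (hmem t).coeFn_toLp.symm
    rw [hS]

end SamplingExpansion

/-! ### A nontrivial relation between two `L²` functions -/

section Annihilation

/-- The obvious solution is `(b, -a)`. Dividing by `1 + |a| + |b|` makes it bounded, hence in `L²`;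
it is used when `b ≠ 0`, and `(0, 1)` serves when `b = 0`. -/
theorem exists_mul_add_mul_eq_zero {α : Type*} [MeasurableSpace α] {ν : Measure α}
    [IsFiniteMeasure ν] [NeZero ν] (a b : Lp ℂ 2 ν) :
    ∃ u v : Lp ℂ 2 ν, (u ≠ 0 ∨ v ≠ 0) ∧ ∀ᵐ ξ ∂ν, a ξ * u ξ + b ξ * v ξ = 0 := by
  by_cases hb : b = 0
  · have h1 : MemLp (fun _ : α => (1 : ℂ)) 2 ν := memLp_const 1
    refine ⟨0, h1.toLp _, Or.inr fun h => ?_, ?_⟩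
    · have h2 : ∀ᵐ _ ∂ν, (1 : ℂ) = 0 := by
        filter_upwards [h1.coeFn_toLp, Lp.coeFn_zero ℂ 2 ν] with ξ h3 h4
        rw [← h3, h, h4]
        rfl
      simp at h2
      exact NeZero.ne ν h2
    · subst hb
      exact Eventually.of_forall fun ξ => by simp
  · have hbound : ∀ {f : α → ℂ}, AEStronglyMeasurable f ν →
        (∀ ξ, ‖f ξ‖ ≤ 1 + ‖a ξ‖ + ‖b ξ‖) →
        MemLp (fun ξ => f ξ / ((1 + ‖a ξ‖ + ‖b ξ‖ : ℝ) : ℂ)) 2 ν := by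
      intro f hf hle
      have ham := (Lp.aestronglyMeasurable a).aemeasurable
      have hbm := (Lp.aestronglyMeasurable b).aemeasurable
      have hfm := hf.aemeasurable
      refine MemLp.of_bound (AEMeasurable.aestronglyMeasurable (by fun_prop)) 1
        (Eventually.of_forall fun ξ => ?_)
      have hpos : 0 < 1 + ‖a ξ‖ + ‖b ξ‖ := by positivity
      rw [norm_div, Complex.norm_real, Real.norm_of_nonneg hpos.le, div_le_one hpos]
      exact hle ξ
    have hu := hbound (Lp.aestronglyMeasurable b) fun ξ => by linarith [norm_nonneg (a ξ)]
    have hv := hbound (Lp.aestronglyMeasurable a).neg fun ξ => by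
      rw [Pi.neg_apply, norm_neg]
      linarith [norm_nonneg (b ξ)]
    refine ⟨hu.toLp _, hv.toLp _, Or.inl fun h => hb (Lp.ext ?_), ?_⟩
    · filter_upwards [hu.coeFn_toLp, Lp.coeFn_zero ℂ 2 ν] with ξ h1 h2
      rw [h, h2] at h1
      have hpos : 0 < 1 + ‖a ξ‖ + ‖b ξ‖ := by positivity
      rw [h2]
      exact (div_eq_zero_iff.mp h1.symm).resolve_right (Complex.ofReal_ne_zero.mpr hpos.ne')
    · filter_upwards [hu.coeFn_toLp, hv.coeFn_toLp] with ξ h1 h2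
      rw [h1, h2, Pi.neg_apply]
      ring

end Annihilation

/-! ### Invariance of the generated space and the number of generators -/

section GeneratedSpace

variable {G ℋ : Type*} [AddCommGroup G] [TopologicalSpace G]
  [NormedAddCommGroup ℋ] [InnerProductSpace ℂ ℋ]
  (U : UnitaryRepresentation G ℋ) {ϕ : ℋ} {H : AddSubgroup G}

theorem generatedSpace_translate {N : ℕ} (Φ : Fin N → ℋ) (t : H) {f : ℋ}
    (hf : f ∈ generatedSpace U H Φ) : U (t : G) f ∈ generatedSpace U H Φ := by
  obtain ⟨x, hx⟩ := hf
  refine ⟨fun n => ⟨fun h => x n (h - t), (lp.memℓp (x n)).comp_equiv (Equiv.subRight t)⟩, ?_⟩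
  have h1 := (U (t : G)).toContinuousLinearEquiv.toContinuousLinearMap.hasSum hx
  have h2 := ((Equiv.refl (Fin N)).prodCongr (Equiv.subRight t)).hasSum_iff.mpr h1
  refine h2.congr_fun fun p => ?_
  change _ = U (t : G) (x p.1 (p.2 - t) • U ((p.2 - t : H) : G) (Φ p.1))
  rw [map_smul, ← U.map_add, AddSubgroup.coe_sub, add_sub_cancel]

/-- Two independent generators produce a nonzero vector whose samples at `H` all vanish. -/
theorem exists_ne_zero_sample_eq_zero [CompleteSpace ℋ] [DiscreteTopology H] {φ ψ : ℋ}
    {E K : lp (fun _ : H => ℂ) 2 →L[ℂ] ℋ}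
    (hE : ∀ h : H, E (lpUnit h) = U (h : G) φ) (hK : ∀ h : H, K (lpUnit h) = U (h : G) ψ) (ϕ : ℋ) :
    ∃ x y, (x ≠ 0 ∨ y ≠ 0) ∧ ∀ t : H, inner ℂ (U (t : G) ϕ) (E x + K y) = 0 := by
  let a : lp (fun _ : H => ℂ) 2 := ⟨_, memℓp_sample U ϕ E hE⟩
  let b : lp (fun _ : H => ℂ) 2 := ⟨_, memℓp_sample U ϕ K hK⟩
  obtain ⟨u, v, hne, huv⟩ := exists_mul_add_mul_eq_zero (fourierL2 a) (fourierL2 b)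
  obtain ⟨x, rfl⟩ := fourierL2_surjective u
  obtain ⟨y, rfl⟩ := fourierL2_surjective v
  refine ⟨x, y, hne.imp (fun h h0 => h (by rw [h0, map_zero])) fun h h0 => h (by rw [h0, map_zero]),
    fun t => ?_⟩
  rw [inner_add_right, inner_eq_integral U ϕ E hE (a := a) (fun _ => rfl),
    inner_eq_integral U ϕ K hK (a := b) (fun _ => rfl), add_eq_zero_iff_eq_neg, ← integral_neg]
  refine integral_congr_ae ?_
  filter_upwards [huv] with ξ hξ
  rw [eq_neg_of_add_eq_zero_left hξ]
  ring

variable {U}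

theorem eq_one_of_injOn_samples [CompleteSpace ℋ] [DiscreteTopology H] [MeasurableSpace G]
    {μ : Measure G} (hframe : IsContinuousFrame μ fun t : G => U t ϕ) {N : ℕ} [NeZero N]
    {Φ : Fin N → ℋ}
    (hΦ : IsRieszBasis (fun p : Fin N × H => U (p.2 : G) (Φ p.1)) (generatedSpace U H Φ))
    (hinj : Set.InjOn (fun (F : G → ℂ) (t : H) => F t) (samplingSpace U ϕ H Φ : Set (G → ℂ))) :
    N = 1 := by
  by_contra hN
  have hN2 : 1 < N := by
    have := NeZero.pos N
    omega
  obtain ⟨e, he⟩ := hΦ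
  let m : Fin N := ⟨0, by omega⟩
  let n : Fin N := ⟨1, hN2⟩
  have hmn : m ≠ n := by simp [m, n]
  have hj : ∀ k : Fin N, Function.Injective fun h : H => (k, h) := fun k => Prod.mk_right_injective k
  let J := fun k : Fin N => lpEmbedding _ (hj k)
  let E : Fin N → lp (fun _ : H => ℂ) 2 →L[ℂ] ℋ := fun k =>
    (generatedSpace U H Φ).subtypeL.comp
      (e.toContinuousLinearMap.comp (J k).toContinuousLinearMap)
  have hE : ∀ k (h : H), E k (lpUnit h) = U (h : G) (Φ k) := by
    intro k h
    refine Eq.trans ?_ (he (k, h))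
    change ((e (J k (lpUnit h)) : generatedSpace U H Φ) : ℋ) = _
    rw [lpEmbedding_lpUnit]
  obtain ⟨x, y, hne, hxy⟩ := exists_ne_zero_sample_eq_zero U (hE m) (hE n) ϕ
  have hEe : E m x + E n y = (e (J m x + J n y) : ℋ) := by
    rw [map_add]
    rfl
  have h0 : analysisMap U ϕ (e (J m x + J n y) : ℋ) = analysisMap U ϕ (0 : ℋ) := by
    refine hinj ⟨_, (e _).2, rfl⟩ ⟨0, Submodule.zero_mem _, rfl⟩ (funext fun t => ?_)
    rw [map_zero, ← hEe]
    exact hxy t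
  have h1 : J m x + J n y = 0 := by
    -- Injectivity of `f ↦ F_f`, then of the synthesis map `e`.
    have h2 := hframe.analysisMap_injective h0
    rw [Submodule.coe_eq_zero] at h2
    exact e.map_eq_zero_iff.mp h2
  -- The two embedded sequences live on disjoint copies of `H`, so a zero sum forces both to vanish.
  have hnot : ∀ {k l : Fin N}, k ≠ l → ∀ h : H, (k, h) ∉ Set.range fun h : H => (l, h) := by
    rintro k l hkl h ⟨h', hh⟩
    exact hkl (congrArg Prod.fst hh).symm
  rcases hne with hx | hy
  · refine hx (lp.ext (funext fun h => ?_))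
    have h3 := congrArg (fun z : lp (fun _ : Fin N × H => ℂ) 2 => z (m, h)) h1
    simpa [J, lpEmbedding_apply_self (hj m) x h,
      lpEmbedding_apply_of_notMem_range (hj n) y (hnot hmn h)] using h3
  · refine hy (lp.ext (funext fun h => ?_))
    have h3 := congrArg (fun z : lp (fun _ : Fin N × H => ℂ) 2 => z (n, h)) h1
    simpa [J, lpEmbedding_apply_self (hj n) y h,
      lpEmbedding_apply_of_notMem_range (hj m) x (hnot hmn.symm h)] using h3

/-- A Riesz basis generated by a single vector, indexed by the group. -/
theorem exists_coordinates_of_isRieszBasis {Φ : Fin 1 → ℋ}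
    (hΦ : IsRieszBasis (fun p : Fin 1 × H => U (p.2 : G) (Φ p.1)) (generatedSpace U H Φ)) :
    ∃ E : lp (fun _ : H => ℂ) 2 ≃L[ℂ] generatedSpace U H Φ,
      ∀ h : H, (E (lpUnit h) : ℋ) = U (h : G) (Φ 0) := by
  obtain ⟨e, he⟩ := hΦ
  have hj : Function.Injective fun h : H => ((0 : Fin 1), h) := Prod.mk_right_injective 0
  have hs : Function.Surjective fun h : H => ((0 : Fin 1), h) := fun p =>
    ⟨p.2, Prod.ext (Subsingleton.elim _ _) rfl⟩
  refine ⟨(LinearIsometryEquiv.ofSurjective (lpEmbedding _ hj)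
    (lpEmbedding_surjective hj hs)).toContinuousLinearEquiv.trans e, fun h => ?_⟩
  refine Eq.trans ?_ (he (0, h))
  change ((e (lpEmbedding _ hj (lpUnit h)) : generatedSpace U H Φ) : ℋ) = _
  rw [lpEmbedding_lpUnit]

end GeneratedSpace
end

theorem corollary2
    {G ℋ : Type*} [AddCommGroup G] [TopologicalSpace G] [IsTopologicalAddGroup G]
    [LocallyCompactSpace G] [T2Space G] [MeasurableSpace G] [BorelSpace G]
    (μ : Measure G) [μ.IsAddHaarMeasure]
    [NormedAddCommGroup ℋ] [InnerProductSpace ℂ ℋ] [CompleteSpace ℋ]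
    [TopologicalSpace.SeparableSpace ℋ]
    (U : UnitaryRepresentation G ℋ) (ϕ : ℋ)
    (hframe : IsContinuousFrame μ fun t : G => U t ϕ)
    (H : AddSubgroup G) [Countable H] [DiscreteTopology H]
    {N : ℕ} [NeZero N] (Φ : Fin N → ℋ)
    (hΦ : IsRieszBasis (fun p : Fin N × H => U (p.2 : G) (Φ p.1)) (generatedSpace U H Φ)) :
    -- if every function of the space is determined by its samples at `H`, then `N = 1`
    (Set.InjOn (fun (F : G → ℂ) (t : H) => F t) (samplingSpace U ϕ H Φ : Set (G → ℂ)) → N = 1) ∧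
    -- for `N = 1`, with the single generator `Φ 0`
    (N = 1 →
      ∃ ha : Memℓp (fun s : H => (inner ℂ (U (s : G) ϕ) (Φ 0) : ℂ)) 2,
        MemLp (fourierL2 (⟨_, ha⟩ : lp (fun _ : H => ℂ) 2)) ∞ (dualHaar H) →
        0 < essInf (fun ξ => ‖fourierL2 (⟨_, ha⟩ : lp (fun _ : H => ℂ) 2) ξ‖ₑ) (dualHaar H) →
        ∃ S ∈ samplingSpace U ϕ H Φ,
          -- the sampling expansion holds: absolutely at each point, uniformly, and in `L²(G)`
          (∀ F ∈ samplingSpace U ϕ H Φ,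
            (∀ s : G, HasSum (fun t : H => F t * S (s - t)) (F s)) ∧
            TendstoUniformly (fun (T : Finset H) (s : G) => ∑ t ∈ T, F t * S (s - t)) F atTop ∧
            Tendsto (fun T : Finset H =>
              eLpNorm (fun s : G => F s - ∑ t ∈ T, F t * S (s - t)) 2 μ) atTop (𝓝 0)) ∧
          -- `S` is unique, even with respect to pointwise convergence
          (∀ S' ∈ samplingSpace U ϕ H Φ,
            (∀ F ∈ samplingSpace U ϕ H Φ, ∀ s : G,
              HasSum (fun t : H => F t * S' (s - t)) (F s)) → S' = S) ∧
          -- its translates by `H` form a Riesz basis of the space, as a subspace of `L²(G)`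
          ∃ hS : ∀ t : H, MemLp (fun s : G => S (s - t)) 2 μ,
            IsRieszBasis (fun t : H => (hS t).toLp (fun s : G => S (s - t)))
              (classesInL2 μ (samplingSpace U ϕ H Φ))) := by
  refine ⟨eq_one_of_injOn_samples hframe hΦ, ?_⟩
  rintro rfl
  obtain ⟨E, hE⟩ := exists_coordinates_of_isRieszBasis hΦ
  let E' : lp (fun _ : H => ℂ) 2 →L[ℂ] ℋ :=
    (generatedSpace U H Φ).subtypeL.comp E.toContinuousLinearMap
  have ha := memℓp_sample U ϕ E' hE
  refine ⟨ha, fun hbdd hpos => ?_⟩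
  obtain ⟨W, hW⟩ := exists_sample_coordinates U ϕ E
    (inner_eq_integral U ϕ E' hE (a := ⟨_, ha⟩) fun _ => rfl) hbdd hpos
  exact exists_sampling_function hframe (fun t _ hf => generatedSpace_translate U Φ t hf) hW
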